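/- Topological search maintains a topological order of a directed graph on a fixed set of $n$ vertices, initially without arcs, under arc additions. The order is stored in arrays $\mathit{position}$ (from the vertices to $\{1,\dots,n\}$) and $\mathit{vertex}$ (its inverse), with an arbitrary initial numbering, and the graph in an adjacency matrix $A$. When an arc $(v,w)$ is added, $A(v,w)$ is set to $1$. If $\mathit{position}(v)<\mathit{position}(w)$ nothing else is done. Otherwise the algorithm does the following. *Search.* Let $F=[w]$ and $B=[v]$ be queues, $i=\mathit{position}(w)$, $j=\mathit{position}(v)$, and set $\mathit{vertex}(i)=\mathit{vertex}(j)=\mathrm{null}$. Repeat the following two phases: (1) $i\leftarrow i+1$; while $i<j$ and $A(u,\mathit{vertex}(i))=0$ for all $u\in F$, do $i\leftarrow i+1$; if $i=j$ stop the search, otherwise add $\mathit{vertex}(i)$ to the back of $F$ and set $\mathit{vertex}(i)=\mathrm{null}$; (2) $j\leftarrow j-1$; while $i<j$ and $A(\mathit{vertex}(j),z)=0$ for all $z\in B$, do $j\leftarrow j-1$; if $i=j$ stop the search, otherwise add $\mathit{vertex}(j)$ to the back of $B$ and set $\mathit{vertex}(j)=\mathrm{null}$. *Cycle test.* If there is an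 arc $(u,z)$ with $u\in F$, $z\in B$, report a cycle and stop the algorithm. *Reordering.* While $F\neq[\,]$: if $\mathit{vertex}(i)\ne\mathrm{null}$ and some $u\in F$ has $A(u,\mathit{vertex}(i))=1$, add $\mathit{vertex}(i)$ to the back of $F$ and set $\mathit{vertex}(i)=\mathrm{null}$; then, if $\mathit{vertex}(i)=\mathrm{null}$, remove the front element $x$ of $F$ and set $\mathit{vertex}(i)=x$, $\mathit{position}(x)=i$; then $i\leftarrow i+1$. After that, while $B\neq[\,]$: $j\leftarrow j-1$; if $\mathit{vertex}(j)\ne\mathrm{null}$ and some $z\in B$ has $A(\mathit{vertex}(j),z)=1$, add $\mathit{vertex}(j)$ to the back of $B$ and set $\mathit{vertex}(j)=\mathrm{null}$; then, if $\mathit{vertex}(j)=\mathrm{null}$, remove the front element $y$ of $B$ and set $\mathit{vertex}(j)=y$, $\mathit{position}(y)=j$. Time is counted on a unit-cost random access machine: each assignment, comparison, queue operation and matrix lookup takes one unit. A test over a queue does one lookup per queue element, from the front, until its outcome is known; the cycle test looks up the pairs in $F\times B$ one by one until an arc is found. The time of a sequence of arc additions is the total over the additions; the initialization is not counted. **Corollary.**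 There is a constant $c>0$ such that for every $n\ge 2$ and every initial numbering of $n$ vertices there is a sequence of additions of distinct arcs, which together form an acyclic graph, on which topological search takes at least $c\,n^2\,2^{\sqrt{2\lg n}}$ time, where $\lg$ is the logarithm to base $2$. -/

import Mathlib

namespace TopSearch

/-! Topological search for incremental topological ordering, with its running time.

Every procedure returns its result together with its running time on a unit-cost random access
machine: one unit for every assignment (to a variable or to an array entry), every comparison,
every queue operation and every lookup in the adjacency matrix.  Queues are lists with the front
at the head.  Positions run from `1` to `n`; an entry of the array `vertex` that equals `none` is
null. -/

variable {V : Type}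

/-- Is there `u` in the queue with `p u`?  The queue is scanned from its front, with one lookup for
each element, and the scan ends with the first success. -/
def scan (p : V → Bool) : List V → Bool × ℕ
  | [] => (false, 0)
  | u :: Q => if p u then (true, 1) else ((scan p Q).1, (scan p Q).2 + 1)

/-- `while i < j and ∀ u ∈ F (A(u, vertex(i)) = 0) do i = i + 1`; the result is the final `i`. -/
def forwardScan (A : V → V → Bool) (vertex : ℕ → Option V) (F : List V) (i j : ℕ) : ℕ × ℕ :=
  if i < j then
    let t := scan (fun u => (vertex i).any fun x => A u x) F
    if t.1 then (i, 1 + t.2)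
    else
      let r := forwardScan A vertex F (i + 1) j
      (r.1, 1 + t.2 + 1 + r.2)
  else (i, 1)
termination_by j - i

/-- `while i < j and ∀ z ∈ B (A(vertex(j), z) = 0) do j = j - 1`; the result is the final `j`. -/
def backwardScan (A : V → V → Bool) (vertex : ℕ → Option V) (B : List V) (i j : ℕ) : ℕ × ℕ :=
  if i < j then
    let t := scan (fun z => (vertex j).any fun x => A x z) B
    if t.1 then (j, 1 + t.2)
    else
      let r := backwardScan A vertex B i (j - 1)
      (r.1, 1 + t.2 + 1 + r.2)
  else (j, 1)
termination_by j - i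

theorem le_forwardScan (A : V → V → Bool) (vertex : ℕ → Option V) (F : List V) (i j : ℕ) :
    i ≤ (forwardScan A vertex F i j).1 := by
  fun_induction forwardScan A vertex F i j <;> grind

theorem backwardScan_le (A : V → V → Bool) (vertex : ℕ → Option V) (B : List V) (i j : ℕ) :
    (backwardScan A vertex B i j).1 ≤ j := by
  fun_induction backwardScan A vertex B i j <;> grind

/-- The two queues, the array `vertex` and the current positions of the two-way search. -/
structure SearchState (V : Type) where
  F : List V
  B : List V
  vertex : ℕ → Option V
  i : ℕ
  j : ℕ

/-- The main loop of the search, which alternates between adding a vertex to `F` and adding a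
vertex to `B`.  It is entered with `i < j`, and `i ≤ j` holds throughout, so that the tests
`i < j` below fail exactly if `i = j`. -/
def searchLoop (A : V → V → Bool) (F B : List V) (vertex : ℕ → Option V) (i j : ℕ) :
    SearchState V × ℕ :=
  -- `i = i + 1`, then the forward scan
  let f := forwardScan A vertex F (i + 1) j
  if f.1 < j then
    -- `inject(vertex(i), F); vertex(i) = null`
    let F₁ := F ++ (vertex f.1).toList
    let vertex₁ := Function.update vertex f.1 none
    -- `j = j - 1`, then the backward scan
    let b := backwardScan A vertex₁ B f.1 (j - 1)
    if f.1 < b.1 then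
      -- `inject(vertex(j), B); vertex(j) = null`
      let B₁ := B ++ (vertex₁ b.1).toList
      let vertex₂ := Function.update vertex₁ b.1 none
      let r := searchLoop A F₁ B₁ vertex₂ f.1 b.1
      (r.1, (1 + f.2 + 1 + 2) + (1 + b.2 + 1 + 2) + r.2)
    else (⟨F₁, B, vertex₁, f.1, b.1⟩, (1 + f.2 + 1 + 2) + (1 + b.2 + 1))
  else (⟨F, B, vertex, f.1, j⟩, 1 + f.2 + 1)
termination_by j - i
decreasing_by
  have h1 := le_forwardScan A vertex F (i + 1) j
  have h2 := backwardScan_le A (Function.update vertex (forwardScan A vertex F (i + 1) j).1 none) B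
    (forwardScan A vertex F (i + 1) j).1 (j - 1)
  grind

/-- The arrays `vertex` and `position` that represent the current topological order. -/
structure Order (V : Type) where
  vertex : ℕ → Option V
  position : V → ℕ

/-- The search that is triggered by a new arc `(v, w)` with `position(w) < position(v)`. -/
def search (A : V → V → Bool) (o : Order V) (v w : V) : SearchState V × ℕ :=
  let i := o.position w
  let j := o.position v
  let r := searchLoop A [w] [v] (Function.update (Function.update o.vertex i none) j none) i j
  (r.1, 8 + r.2)

/-- Is there an arc from the queue `F` to the queue `B`?  The pairs are tested one by one until an
arc is found. -/
def cycleTest (A : V → V → Bool) (B : List V) : List V → Bool × ℕ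
  | [] => (false, 0)
  | u :: F =>
    let t := scan (A u) B
    if t.1 then (true, t.2) else ((cycleTest A B F).1, t.2 + (cycleTest A B F).2)

section Reorder

variable [DecidableEq V]

/-- The part of the reordering loops that fills position `i` of the order: if `vertex(i)` is null,
pop the front `x` of the queue `Q`, and set `vertex(i) = x`, `position(x) = i`. -/
def refill (Q : List V) (o : Order V) (i : ℕ) : (List V × Order V) × ℕ :=
  match o.vertex i, Q with
  | none, x :: Q' =>
    ((Q', ⟨Function.update o.vertex i (some x), Function.update o.position x i⟩), 1 + 3)
  | _, _ => ((Q, o), 1)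

/-- The forward loop of the reordering, `while F ≠ [] do ...`, from position `i`.  (The array ends
at `n`; the loop empties `F` before it leaves the array.) -/
def reorderForward (n : ℕ) (A : V → V → Bool) (F : List V) (o : Order V) (i : ℕ) :
    Order V × ℕ :=
  if F ≠ [] ∧ i ≤ n then
    let t := scan (fun u => (o.vertex i).any fun x => A u x) (if (o.vertex i).isSome then F else [])
    let s : (List V × Order V) × ℕ :=
      if t.1 then
        refill (F ++ (o.vertex i).toList) ⟨Function.update o.vertex i none, o.position⟩ i
      else refill F o i
    let r := reorderForward n A s.1.1 s.1.2 (i + 1)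
    (r.1, 1 + (1 + t.2) + (if t.1 then 2 else 0) + s.2 + 1 + r.2)
  else (o, 1)
termination_by n + 1 - i

/-- The backward loop of the reordering, `while B ≠ [] do ...`, from position `j - 1` downward.
(The loop empties `B` before it leaves the array.) -/
def reorderBackward (A : V → V → Bool) (B : List V) (o : Order V) (j : ℕ) : Order V × ℕ :=
  if B ≠ [] ∧ 1 < j then
    let t := scan (fun z => (o.vertex (j - 1)).any fun x => A x z)
      (if (o.vertex (j - 1)).isSome then B else [])
    let s : (List V × Order V) × ℕ :=
      if t.1 then
        refill (B ++ (o.vertex (j - 1)).toList)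
          ⟨Function.update o.vertex (j - 1) none, o.position⟩ (j - 1)
      else refill B o (j - 1)
    let r := reorderBackward A s.1.1 s.1.2 (j - 1)
    (r.1, 1 + 1 + (1 + t.2) + (if t.1 then 2 else 0) + s.2 + r.2)
  else (o, 1)
termination_by j

/-- Addition of the arc `(v, w)` to the graph with adjacency matrix `A` and order `o`.  The result
is `none` if a cycle is reported, and the new matrix and order otherwise. -/
def addArc (n : ℕ) (A : V → V → Bool) (o : Order V) (v w : V) :
    Option ((V → V → Bool) × Order V) × ℕ :=
  let A' : V → V → Bool := fun x y => A x y || (decide (x = v) && decide (y = w))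
  if o.position w < o.position v then
    let s := search A' o v w
    let c := cycleTest A' s.1.B s.1.F
    if c.1 then (none, 2 + s.2 + c.2)
    else
      let f := reorderForward n A' s.1.F ⟨s.1.vertex, o.position⟩ s.1.i
      let b := reorderBackward A' s.1.B f.1 s.1.j
      (some (A', b.1), 2 + s.2 + c.2 + f.2 + b.2)
  else (some (A', o), 2)

/-- Total time for a sequence of arc additions, starting from a given graph and order.  The
algorithm stops if it reports a cycle. -/
def timeFrom (n : ℕ) (A : V → V → Bool) (o : Order V) : List (V × V) → ℕ
  | [] => 0
  | a :: arcs =>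
    let r := addArc n A o a.1 a.2
    match r.1 with
    | none => r.2
    | some s => r.2 + timeFrom n s.1 s.2 arcs

end Reorder

/-- The order in which vertex `v` has position `σ v + 1`, so that the positions are `1, …, n`. -/
def initialOrder {n : ℕ} (σ : Equiv.Perm (Fin n)) : Order (Fin n) where
  vertex i := if h : 1 ≤ i ∧ i ≤ n then some (σ.symm ⟨i - 1, by omega⟩) else none
  position v := (σ v : ℕ) + 1

/-- The time that topological search takes on a sequence of arc additions to the graph with vertex
set `Fin n` and no arcs, if the initial numbering of the vertices is `σ`. -/
def time {n : ℕ} (σ : Equiv.Perm (Fin n)) (arcs : List (Fin n × Fin n)) : ℕ :=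
  timeFrom n (fun _ _ => false) (initialOrder σ) arcs

/-- No arc is repeated, and the graph formed by all the arcs has no cycle (in particular no
loop). -/
def IsAcyclicSequence (arcs : List (V × V)) : Prop :=
  arcs.Nodup ∧ ∀ v, ¬ Relation.TransGen (fun x y => (x, y) ∈ arcs) v v

end TopSearch

/-!
Number the vertices so that two lists of `H` labelled vertices stand on either side of `K` isolated
ones, and add only arcs that exchange two labelled vertices which are adjacent apart from isolated
vertices, the smaller label coming first.  All arcs lead to a smaller label, so no cycle arises, and
an exchange across the median of the labelled vertices scans all `K` isolated ones.

It remains to make many exchanges across the median.  Take a run of such exchanges and replace each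
entry by a bundle of `N` entries, which undergoes one more round of odd-even transposition each time
the entry crosses the median: a crossing of two entries turns into `2 * N - 1` crossings, since
turning the pairs of a bundle around is done at the median as well.  A bundle survives `N` rounds,
and each of its entries crosses about twice as often as the original entry.  With `N = 2, 4, 8, …`
in turn, the size is `2 ^ (i * (i + 1) / 2)` after `i` steps while the number of crossings exceeds
the size by a factor of about `2 ^ i`, which is `2 ^ √(2 * lg n)` up to a constant.
-/

namespace TopSearch

section MedianRun

variable {α : Type*} [LT α]

/-- One bubble-sort step: two adjacent entries, the smaller one first, trade places. -/
inductive AdjSwap : List α → List α → Prop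
  | intro (l₁ l₂ : List α) {a b : α} (hab : a < b) :
      AdjSwap (l₁ ++ a :: b :: l₂) (l₁ ++ b :: a :: l₂)

theorem AdjSwap.append_left {l l' : List α} (h : AdjSwap l l') (k : List α) :
    AdjSwap (k ++ l) (k ++ l') := by
  obtain ⟨l₁, l₂, hab⟩ := h
  simpa only [List.append_assoc] using AdjSwap.intro (k ++ l₁) l₂ hab

theorem AdjSwap.append_right {l l' : List α} (h : AdjSwap l l') (k : List α) :
    AdjSwap (l ++ k) (l' ++ k) := by
  obtain ⟨l₁, l₂, hab⟩ := h
  simpa only [List.append_assoc, List.cons_append] using AdjSwap.intro l₁ (l₂ ++ k) hab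

theorem AdjSwap.perm {l l' : List α} (h : AdjSwap l l') : l.Perm l' := by
  obtain ⟨l₁, l₂, -⟩ := h
  exact (List.Perm.swap _ _ _).append_left l₁

/-- `l'` is reached from `l` by bubble-sort steps. -/
abbrev AdjSwaps : List α → List α → Prop := Relation.ReflTransGen AdjSwap

theorem AdjSwaps.append_left {l l' : List α} (h : AdjSwaps l l') (k : List α) :
    AdjSwaps (k ++ l) (k ++ l') :=
  h.lift (k ++ ·) fun _ _ h => h.append_left k

theorem AdjSwaps.append_right {l l' : List α} (h : AdjSwaps l l') (k : List α) :
    AdjSwaps (l ++ k) (l' ++ k) :=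
  h.lift (· ++ k) fun _ _ h => h.append_right k

theorem adjSwaps_cons_append {a : α} {Y : List α} (h : ∀ y ∈ Y, a < y) :
    AdjSwaps (a :: Y) (Y ++ [a]) := by
  induction Y with
  | nil => exact .refl
  | cons y Y ih =>
    rw [List.forall_mem_cons] at h
    exact .head (.intro [] Y h.1) ((ih h.2).append_left [y])

theorem adjSwaps_append_comm {X Y : List α} (h : ∀ x ∈ X, ∀ y ∈ Y, x < y) :
    AdjSwaps (X ++ Y) (Y ++ X) := by
  induction X with
  | nil => simpa using Relation.ReflTransGen.refl
  | cons x X ih =>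
    rw [List.forall_mem_cons] at h
    have hX : AdjSwaps (x :: (X ++ Y)) (x :: (Y ++ X)) := (ih h.2).append_left [x]
    have hx : AdjSwaps (x :: (Y ++ X)) (Y ++ x :: X) := by
      simpa using (adjSwaps_cons_append h.1).append_right X
    exact hX.trans hx

/-- `MedianRun P Q P' Q' s`: bubble-sort steps transform the list `P ++ Q` into `P' ++ Q'`, where
`P` and `P'` have the same length.  A step across the median exchanges the last entry of the left
part with the first entry of the right part; the multiset `s` contains every entry once for each
step across the median in which it takes part. -/
inductive MedianRun : List α → List α → List α → List α → Multiset α → Prop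
  | refl (P Q : List α) : MedianRun P Q P Q 0
  | left {P P₁ Q P' Q' : List α} {s : Multiset α} (hP : AdjSwap P P₁)
      (h : MedianRun P₁ Q P' Q' s) : MedianRun P Q P' Q' s
  | right {P Q Q₁ P' Q' : List α} {s : Multiset α} (hQ : AdjSwap Q Q₁)
      (h : MedianRun P Q₁ P' Q' s) : MedianRun P Q P' Q' s
  | mid {P Q P' Q' : List α} {s : Multiset α} {a b : α} (hab : a < b)
      (h : MedianRun (P ++ [b]) (a :: Q) P' Q' s) :
      MedianRun (P ++ [a]) (b :: Q) P' Q' ({a, b} + s)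

namespace MedianRun

variable {P Q P' Q' : List α} {s : Multiset α}

theorem trans {P'' Q'' : List α} {s' : Multiset α} (h : MedianRun P Q P' Q' s)
    (h' : MedianRun P' Q' P'' Q'' s') : MedianRun P Q P'' Q'' (s + s') := by
  induction h with
  | refl => simpa using h'
  | left hP _ ih => exact left hP (ih h')
  | right hQ _ ih => exact right hQ (ih h')
  | mid hab _ ih => rw [add_assoc]; exact mid hab (ih h')

theorem left_of_adjSwaps {P₁ : List α} (hP : AdjSwaps P P₁) (h : MedianRun P₁ Q P' Q' s) :
    MedianRun P Q P' Q' s := by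
  induction hP using Relation.ReflTransGen.head_induction_on with
  | refl => exact h
  | head hP _ ih => exact left hP ih

theorem right_of_adjSwaps {Q₁ : List α} (hQ : AdjSwaps Q Q₁) (h : MedianRun P Q₁ P' Q' s) :
    MedianRun P Q P' Q' s := by
  induction hQ using Relation.ReflTransGen.head_induction_on with
  | refl => exact h
  | head hQ _ ih => exact right hQ ih

theorem append (h : MedianRun P Q P' Q' s) (l₁ l₂ : List α) :
    MedianRun (l₁ ++ P) (Q ++ l₂) (l₁ ++ P') (Q' ++ l₂) s := by
  induction h with
  | refl => exact refl _ _
  | left hP _ ih => exact left (hP.append_left l₁) ih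
  | right hQ _ ih => exact right (hQ.append_right l₂) ih
  | mid hab _ ih =>
    rw [← List.append_assoc] at ih ⊢
    exact mid hab ih

end MedianRun

/-- The entries of a list of pairs, in order. -/
def flat {β : Type*} (ps : List (β × β)) : List β := ps.flatMap fun p => [p.1, p.2]

section Flat

variable {β : Type*}

@[simp] theorem flat_nil : flat ([] : List (β × β)) = [] := rfl

@[simp] theorem flat_cons (p : β × β) (ps : List (β × β)) :
    flat (p :: ps) = p.1 :: p.2 :: flat ps := rfl

@[simp] theorem flat_append (ps qs : List (β × β)) : flat (ps ++ qs) = flat ps ++ flat qs :=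
  List.flatMap_append

theorem map_flat {γ : Type*} (f : β → γ) (ps : List (β × β)) :
    (flat ps).map f = flat (ps.map (Prod.map f f)) := by
  induction ps with
  | nil => rfl
  | cons p ps ih => simp [ih]

end Flat

theorem MedianRun.exchange_pair {b b' y z : α} (hb : b < b') (hby : b < y) (hb'y : b' < y)
    (hbz : b < z) (hb'z : b' < z) :
    MedianRun [b, b'] [y, z] [y, z] [b', b] ({b', y} + ({b, b'} + {b', z})) := by
  have h₁ : MedianRun [y, b'] [z, b] [y, z] [b', b] ({b', z} + 0) :=
    .mid (P := [y]) hb'z (.refl _ _)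
  have h₂ : MedianRun [y, b] [b', z] [y, z] [b', b] ({b, b'} + ({b', z} + 0)) :=
    .mid (P := [y]) hb (.right (.intro [] [] hbz) h₁)
  simpa using MedianRun.mid (P := [b]) hb'y (.left (.intro [] [] hby) h₂)

theorem MedianRun.cons_exchange_pair {X Y P' Q' : List α} {s : Multiset α} {b b' y y₁ y₂ : α}
    (h : MedianRun X (y₁ :: Y) P' Q' s) (hb : b < b') (hy : y₁ < y₂)
    (hX : ∀ x ∈ X, x < y ∧ x < y₂) (hY : ∀ v ∈ y :: y₁ :: y₂ :: Y, b < v ∧ b' < v) :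
    MedianRun (X ++ [b, b']) (y :: y₁ :: y₂ :: Y) (y :: y₂ :: P') (Q' ++ [b', b])
      (({b', y} + ({b, b'} + {b', y₁})) + ({y₁, y₂} + s)) := by
  simp only [List.forall_mem_cons] at hY
  obtain ⟨⟨hby, hb'y⟩, ⟨hby₁, hb'y₁⟩, ⟨hby₂, hb'y₂⟩, hY⟩ := hY
  have hpair : MedianRun (X ++ [b, b']) (y :: y₁ :: y₂ :: Y) (X ++ [y, y₁])
      (b' :: b :: y₂ :: Y) _ :=
    (exchange_pair hb hby hb'y hby₁ hb'y₁).append X (y₂ :: Y)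
  have hpass : AdjSwaps (b' :: b :: y₂ :: Y) (y₂ :: b' :: b :: Y) :=
    (adjSwaps_append_comm (X := [b', b]) (Y := [y₂]) (by simp [*])).append_right Y
  have hleft : AdjSwaps (X ++ [y, y₂]) (y :: y₂ :: X) := adjSwaps_append_comm (by grind)
  have hright : AdjSwaps (y₁ :: b' :: b :: Y) (y₁ :: Y ++ [b', b]) :=
    (adjSwaps_append_comm (X := [b', b]) (by grind)).append_left [y₁]
  have hrest : MedianRun (X ++ [y, y₂]) (y₁ :: b' :: b :: Y) (y :: y₂ :: P') (Q' ++ [b', b]) s :=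
    left_of_adjSwaps hleft (right_of_adjSwaps hright (h.append [y, y₂] [b', b]))
  refine hpair.trans (right_of_adjSwaps hpass ?_)
  simpa using mid (P := X ++ [y]) hy (by simpa using hrest)

/-- Each pair of `xs` and of `ys` is turned around at the median.  Working from the median outwards,
the last pair of `xs` trades places with `y` and the first entry of `ys`, and then the first pair of
`ys` is turned around. -/
theorem MedianRun.exchange {xs ys : List (α × α)} {y z : α} (hlen : xs.length = ys.length + 1)
    (hxs : ∀ p ∈ xs, p.1 < p.2) (hys : ∀ p ∈ ys, p.1 < p.2)
    (hxy : ∀ x ∈ flat xs, ∀ v ∈ y :: (flat ys ++ [z]), x < v) :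
    MedianRun (flat xs) (y :: (flat ys ++ [z]))
      (y :: (flat (ys.map Prod.swap) ++ [z])) (flat (xs.map Prod.swap))
      ((xs.map Prod.fst + 3 • (xs.map Prod.snd : Multiset α)) +
        ({y, z} + 3 • (ys.map Prod.fst : Multiset α) + ys.map Prod.snd)) := by
  induction ys generalizing xs y with
  | nil =>
    obtain ⟨⟨b, b'⟩, rfl⟩ : ∃ p, xs = [p] := List.length_eq_one_iff.1 hlen
    simp only [flat_cons, flat_nil, List.forall_mem_cons, List.nil_append] at hxs hxy
    obtain ⟨⟨hby, hbz, -⟩, ⟨hb'y, hb'z, -⟩, -⟩ := hxy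
    convert! exchange_pair hxs.1 hby hb'y hbz hb'z using 1
    simp only [List.map_cons, List.map_nil, Multiset.coe_singleton, Multiset.coe_nil,
      Multiset.insert_eq_cons, ← Multiset.singleton_add, smul_zero, add_zero]
    abel
  | cons q ys ih =>
    obtain ⟨y₁, y₂⟩ := q
    obtain ⟨xs, ⟨b, b'⟩, rfl⟩ : ∃ xs' p, xs = xs' ++ [p] :=
      (List.eq_nil_or_concat' xs).resolve_left (by rintro rfl; simp at hlen)
    rw [List.forall_mem_append, List.forall_mem_singleton] at hxs
    rw [List.forall_mem_cons] at hys
    simp only [flat_append, flat_cons, flat_nil, List.cons_append] at hxy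
    have hrest := ih (xs := xs) (y := y₁) (by simpa using hlen) hxs.1 hys.2
      fun x hx v hv => hxy x (by simp [hx]) v (by grind)
    convert! hrest.cons_exchange_pair (y := y) hxs.2 hys.1
      (fun x hx => ⟨hxy x (by simp [hx]) y (by simp), hxy x (by simp [hx]) y₂ (by simp)⟩)
      (fun v hv => ⟨hxy b (by simp) v hv, hxy b' (by simp) v hv⟩) using 1
    · simp
    · simp
    · simp only [List.map_cons, List.map_append, List.map_nil, ← Multiset.cons_coe,
        ← Multiset.coe_add, Multiset.coe_nil, Multiset.insert_eq_cons, ← Multiset.singleton_add,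
        smul_add, add_zero]
      abel

end MedianRun

section Evens

variable {β : Type*}

/-- The entries with even index. -/
def evens : List β → List β
  | [] => []
  | [x] => [x]
  | x :: _ :: l => x :: evens l

theorem evens_sublist (l : List β) : (evens l).Sublist l := by
  fun_induction evens l with
  | case1 | case2 => rfl
  | case3 x y l ih => exact (ih.cons y).cons_cons x

theorem evens_flat (ps : List (β × β)) : evens (flat ps) = ps.map Prod.fst := by
  induction ps with
  | nil => rfl
  | cons p ps ih => simp [evens, ih]

theorem evens_cons_flat (y z : β) (ps : List (β × β)) :
    evens (y :: (flat ps ++ [z])) = y :: ps.map Prod.snd := by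
  induction ps generalizing y with
  | nil => rfl
  | cons p ps ih => simp [evens, ih]

theorem count_flat [DecidableEq β] (ps : List (β × β)) (x : β) :
    (flat ps).count x = (ps.map Prod.fst).count x + (ps.map Prod.snd).count x := by
  induction ps with
  | nil => rfl
  | cons p ps ih => simp only [flat_cons, List.map_cons, List.count_cons, ih]; omega

theorem count_add_count_evens_flat_le [DecidableEq β] {ps : List (β × β)} (h : (flat ps).Nodup)
    (x : β) : (ps.map Prod.fst + 3 • (ps.map Prod.snd : Multiset β)).count x +
      (evens (flat ps)).count x ≤ 2 + (evens (flat (ps.map Prod.swap))).count x := by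
  have hx := List.nodup_iff_count_le_one.1 h x
  rw [count_flat] at hx
  simp only [evens_flat, List.map_map, Multiset.count_add, Multiset.count_nsmul,
    Multiset.coe_count]
  change _ ≤ 2 + (ps.map Prod.snd).count x
  omega

theorem count_add_count_evens_cons_flat_le [DecidableEq β] {ps : List (β × β)} {y z : β}
    (h : (y :: (flat ps ++ [z])).Nodup) (x : β) :
    ({y, z} + 3 • (ps.map Prod.fst : Multiset β) + ps.map Prod.snd).count x +
      (evens (y :: (flat ps ++ [z]))).count x ≤
        2 + (evens (y :: (flat (ps.map Prod.swap) ++ [z]))).count x := by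
  have hx := List.nodup_iff_count_le_one.1 h x
  rw [List.count_cons, List.count_append, count_flat, List.count_singleton] at hx
  simp only [evens_cons_flat, List.map_map, Multiset.count_add, Multiset.count_nsmul,
    Multiset.coe_count, Multiset.insert_eq_cons, Multiset.count_cons, Multiset.count_singleton,
    List.count_cons, beq_iff_eq, @eq_comm _ x] at hx ⊢
  change _ ≤ 2 + ((ps.map Prod.fst).count x + _)
  omega

end Evens

section Row

/-- Entry number `p` after `s` rounds of odd-even transposition of the list `0, …, N - 1`, where
the round `s` swaps the entries `p, p + 1` with `p + s` even. -/
def label (N s p : ℕ) : ℕ :=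
  if (p + s) % 2 = 0 then (if s ≤ p then p - s else s - p - 1)
  else (if p + s < N then p + s else 2 * N - 1 - p - s)

variable {M N s p : ℕ}

theorem label_injOn (hs : s ≤ N) : Set.InjOn (label N s) (Set.Iio N) := by
  intro p hp q hq h
  rw [Set.mem_Iio] at hp hq
  unfold label at h; split_ifs at h <;> omega

theorem label_lt_label (hs : s < N) (hp : p + 1 < N) (h : (p + s) % 2 = 0) :
    label N s p < label N s (p + 1) := by
  unfold label; split_ifs <;> omega

theorem label_succ_left (h : (p + s) % 2 = 0) : label N (s + 1) p = label N s (p + 1) := by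
  unfold label; split_ifs <;> omega

theorem label_succ_right (h : (p + s) % 2 = 0) : label N (s + 1) (p + 1) = label N s p := by
  unfold label; split_ifs <;> omega

theorem label_succ_zero (hs : s < N) (h : s % 2 = 1) : label N (s + 1) 0 = label N s 0 := by
  unfold label; split_ifs <;> omega

theorem label_succ_last (hs : s < N) (h : (p + s) % 2 = 0) (hp : p + 1 = N) :
    label N (s + 1) p = label N s p := by
  unfold label; split_ifs <;> omega

/-- The list `0, …, N - 1` after `s` rounds of odd-even transposition. -/
def row (N s : ℕ) : List ℕ := (List.range N).map (label N s)

theorem length_row : (row N s).length = N := by simp [row]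

theorem nodup_row (hs : s ≤ N) : (row N s).Nodup :=
  List.nodup_range.map_on fun _ hp _ hq =>
    label_injOn hs (List.mem_range.1 hp) (List.mem_range.1 hq)

theorem map_range_two_mul {β : Type*} (f : ℕ → β) (M : ℕ) : (List.range (2 * M)).map f =
    flat ((List.range M).map fun j => (f (2 * j), f (2 * j + 1))) := by
  induction M with
  | zero => rfl
  | succ M ih => simp [mul_add, List.range_succ, ih]

theorem map_range_two_mul_succ {β : Type*} (f : ℕ → β) (M : ℕ) :
    (List.range (2 * (M + 1))).map f =
      f 0 :: (flat ((List.range M).map fun j => (f (2 * j + 1), f (2 * j + 2))) ++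
        [f (2 * M + 1)]) := by
  induction M with
  | zero => rfl
  | succ M ih =>
    rw [show 2 * (M + 1 + 1) = 2 * (M + 1) + 1 + 1 by ring, List.range_succ, List.range_succ,
      List.map_append, List.map_append, ih]
    simp [mul_add, List.range_succ]

theorem exists_row_eq_of_even (hs : s < 2 * M) (hs2 : Even s) : ∃ xs : List (ℕ × ℕ),
    xs.length = M ∧ (∀ p ∈ xs, p.1 < p.2) ∧ row (2 * M) s = flat xs ∧
      row (2 * M) (s + 1) = flat (xs.map Prod.swap) := by
  rw [Nat.even_iff] at hs2
  refine ⟨_, by simp, ?_, map_range_two_mul _ _, ?_⟩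
  · rw [List.forall_mem_map]
    intro j hj
    rw [List.mem_range] at hj
    exact label_lt_label hs (by omega) (by omega)
  · rw [row, map_range_two_mul, List.map_map]
    congr 1
    exact List.map_congr_left fun j _ =>
      Prod.ext (label_succ_left (by omega)) (label_succ_right (by omega))

theorem exists_row_eq_of_odd (hs : s < 2 * (M + 1)) (hs2 : Odd s) : ∃ y ys z,
    ys.length = M ∧ (∀ p ∈ ys, p.1 < p.2) ∧ row (2 * (M + 1)) s = y :: (flat ys ++ [z]) ∧
      row (2 * (M + 1)) (s + 1) = y :: (flat (ys.map Prod.swap) ++ [z]) := by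
  rw [Nat.odd_iff] at hs2
  refine ⟨_, _, _, by simp, ?_, map_range_two_mul_succ _ _, ?_⟩
  · rw [List.forall_mem_map]
    intro j hj
    rw [List.mem_range] at hj
    exact label_lt_label hs (by omega) (by omega)
  · rw [row, map_range_two_mul_succ, List.map_map, label_succ_zero hs hs2,
      label_succ_last hs (by omega) (by omega)]
    congr 3
    exact List.map_congr_left fun j _ =>
      Prod.ext (label_succ_left (by omega)) (label_succ_right (by omega))

/-- How often `p` (at most once) occurs at an even index of `row N s`. -/
def evenCount (N s p : ℕ) : ℕ := (evens (row N s)).count p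

theorem evenCount_le_one (hs : s ≤ N) : evenCount N s p ≤ 1 :=
  ((evens_sublist _).count_le p).trans (List.nodup_iff_count_le_one.1 (nodup_row hs) p)

end Row

section Bundle

variable {α : Type*}

/-- The `N` entries that replace the entry `x`, in their order after `s` rounds. -/
def bundle (N s : ℕ) (x : α) : List (α ×ₗ ℕ) := (row N s).map fun p => toLex (x, p)

theorem lt_of_mem_bundle [LT α] {N s t : ℕ} {a b : α} {v w : α ×ₗ ℕ} (hab : a < b)
    (hv : v ∈ bundle N s a) (hw : w ∈ bundle N t b) : v < w := by
  obtain ⟨p, -, rfl⟩ := List.mem_map.1 hv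
  obtain ⟨q, -, rfl⟩ := List.mem_map.1 hw
  exact Prod.Lex.toLex_lt_toLex.2 (.inl hab)

/-- An entry takes part in one or in three of the steps across the median, depending on the parity
of its index in its bundle; in a whole run the `evenCount` terms telescope, so that entries take
part in two steps per round on average. -/
theorem MedianRun.exchange_bundle [LT α] {N s t : ℕ} {a b : α} (hN : Even N) (hab : a < b)
    (hs : s < N) (ht : t < N) (hs2 : Even s) (ht2 : Odd t) : ∃ S T : Multiset ℕ,
    MedianRun (bundle N s a) (bundle N t b) (bundle N (t + 1) b) (bundle N (s + 1) a)
      ((S.map fun p => toLex (a, p)) + T.map fun p => toLex (b, p)) ∧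
    S.card + T.card = 2 * (2 * N - 1) ∧
    ∀ p, S.count p + evenCount N s p ≤ 2 + evenCount N (s + 1) p ∧
      T.count p + evenCount N t p ≤ 2 + evenCount N (t + 1) p := by
  obtain ⟨M, rfl⟩ : ∃ M, N = 2 * (M + 1) := by
    obtain ⟨M, rfl⟩ := hN
    exact ⟨M - 1, by omega⟩
  obtain ⟨xs, hxs, hlt, hrow, hrow'⟩ := exists_row_eq_of_even hs hs2
  obtain ⟨y, ys, z, hys, hlt', hrowt, hrowt'⟩ := exists_row_eq_of_odd ht ht2
  refine ⟨xs.map Prod.fst + 3 • (xs.map Prod.snd : Multiset ℕ),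
    {y, z} + 3 • (ys.map Prod.fst : Multiset ℕ) + ys.map Prod.snd, ?_, ?_, fun p => ⟨?_, ?_⟩⟩
  · have hcross : ∀ v ∈ bundle (2 * (M + 1)) s a,
        ∀ w ∈ bundle (2 * (M + 1)) t b, v < w := fun v hv w hw =>
      lt_of_mem_bundle hab hv hw
    simp only [bundle, hrow, hrow', hrowt, hrowt', map_flat, List.map_cons, List.map_append,
      List.map_nil] at hcross ⊢
    convert! exchange (by simp [hxs, hys]) ?_ ?_ hcross using 1
    · simp only [List.map_map]; rfl
    · simp only [List.map_map]; rfl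
    · simp only [Multiset.map_add, Multiset.map_nsmul, Multiset.map_coe, List.map_map,
        Multiset.insert_eq_cons, Multiset.map_cons, Multiset.map_singleton]
      rfl
    · rw [List.forall_mem_map]
      exact fun p hp => Prod.Lex.toLex_lt_toLex.2 (.inr ⟨rfl, hlt p hp⟩)
    · rw [List.forall_mem_map]
      exact fun p hp => Prod.Lex.toLex_lt_toLex.2 (.inr ⟨rfl, hlt' p hp⟩)
  · simp only [Multiset.card_add, Multiset.card_nsmul, Multiset.coe_card, List.length_map,
      Multiset.card_pair, hxs, hys]
    omega
  · rw [evenCount, evenCount, hrow, hrow']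
    exact count_add_count_evens_flat_le (hrow ▸ nodup_row hs.le) p
  · rw [evenCount, evenCount, hrowt, hrowt']
    exact count_add_count_evens_cons_flat_le (hrowt ▸ nodup_row ht.le) p

theorem count_map_toLex [DecidableEq α] (S : Multiset ℕ) (a x : α) (p : ℕ) :
    (S.map fun p => toLex (a, p)).count (toLex (x, p)) = if x = a then S.count p else 0 := by
  split_ifs with h
  · subst h
    exact Multiset.count_map_eq_count' _ S (fun p q h => congrArg (fun y => (ofLex y).2) h) p
  · rw [Multiset.count_eq_zero, Multiset.mem_map]
    rintro ⟨q, -, hq⟩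
    exact h (congrArg (fun y => (ofLex y).1) hq).symm

/-- The list `l` with each entry `x` replaced by its bundle after `φ x` rounds. -/
def bundles (N : ℕ) (φ : α → ℕ) (l : List α) : List (α ×ₗ ℕ) := l.flatMap fun x => bundle N (φ x) x

variable {N : ℕ} {φ ψ : α → ℕ} {l : List α}

@[simp] theorem bundles_cons {x : α} :
    bundles N φ (x :: l) = bundle N (φ x) x ++ bundles N φ l := rfl

@[simp] theorem bundles_append {l' : List α} :
    bundles N φ (l ++ l') = bundles N φ l ++ bundles N φ l' := List.flatMap_append

@[simp] theorem bundles_nil : bundles N φ [] = [] := rfl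

theorem bundles_congr (h : ∀ x ∈ l, φ x = ψ x) : bundles N φ l = bundles N ψ l := by
  induction l with
  | nil => rfl
  | cons x l ih =>
    rw [List.forall_mem_cons] at h
    rw [bundles_cons, bundles_cons, h.1, ih h.2]

theorem length_bundles : (bundles N φ l).length = l.length * N := by
  simp [bundles, bundle, length_row]

theorem nodup_bundles (hl : l.Nodup) (hφ : ∀ x ∈ l, φ x ≤ N) : (bundles N φ l).Nodup := by
  refine List.nodup_flatMap.2 ⟨fun x hx => (nodup_row (hφ x hx)).map fun p q h =>
    congrArg (fun y => (ofLex y).2) h, hl.imp fun {x y} hxy => ?_⟩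
  simp only [Function.onFun, List.disjoint_left, bundle, List.mem_map, not_exists, not_and]
  rintro _ ⟨p, -, rfl⟩ q - h
  exact hxy (congrArg (fun y => (ofLex y).1) h).symm

end Bundle

section Lift

variable {α : Type*} {N : ℕ} {φ : α → ℕ}

theorem AdjSwap.adjSwaps_bundles [LT α] {l l' : List α} (h : AdjSwap l l') :
    AdjSwaps (bundles N φ l) (bundles N φ l') := by
  obtain ⟨l₁, l₂, hab⟩ := h
  simpa using ((adjSwaps_append_comm fun _ hv _ hw => lt_of_mem_bundle hab hv hw).append_right
    (bundles N φ l₂)).append_left (bundles N φ l₁)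

theorem count_pair [DecidableEq α] {a b : α} (hab : a ≠ b) (x : α) :
    ({a, b} : Multiset α).count x = if x = a ∨ x = b then 1 else 0 := by
  rw [Multiset.insert_eq_cons, Multiset.count_cons, Multiset.count_singleton]
  grind

namespace MedianRun

variable [Preorder α] [DecidableEq α] {P Q P' Q' : List α}

theorem lift_mid {a b : α} (hN : Even N) (hab : a < b) (hnd : (P ++ [a] ++ b :: Q).Nodup)
    (ha : Even (φ a)) (hb : Odd (φ b)) (haN : φ a < N) (hbN : φ b < N) :
    ∃ s', MedianRun (bundles N φ (P ++ [a])) (bundles N φ (b :: Q))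
      (bundles N (fun x => φ x + ({a, b} : Multiset α).count x) (P ++ [b]))
      (bundles N (fun x => φ x + ({a, b} : Multiset α).count x) (a :: Q)) s' ∧
      s'.card = 2 * (2 * N - 1) ∧ ∀ x p, s'.count (toLex (x, p)) + evenCount N (φ x) p ≤
        2 * ({a, b} : Multiset α).count x +
          evenCount N (φ x + ({a, b} : Multiset α).count x) p := by
  obtain ⟨S, T, hrun, hcard, hcount⟩ := exchange_bundle hN hab haN hbN ha hb
  have hc := count_pair hab.ne
  have hfix {l : List α} (hl : ∀ x ∈ l, ¬(x = a ∨ x = b)) :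
      bundles N (fun x => φ x + ({a, b} : Multiset α).count x) l = bundles N φ l :=
    bundles_congr fun x hx => by rw [hc, if_neg (hl x hx), add_zero]
  refine ⟨_, ?_, (by simpa only [Multiset.card_add, Multiset.card_map] using hcard :
    ((S.map fun p => toLex (a, p)) + T.map fun p => toLex (b, p)).card = _), fun x p => ?_⟩
  · have := hrun.append (bundles N φ P) (bundles N φ Q)
    simp only [bundles_append, bundles_cons, bundles_nil, List.append_nil,
      hfix (l := P) (by grind), hfix (l := Q) (by grind)]
    simpa only [hc, true_or, or_true, if_true] using this
  · rw [Multiset.count_add, count_map_toLex, count_map_toLex, hc]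
    have := hab.ne
    grind

theorem lift (hN : Even N) {s : Multiset α} (h : MedianRun P Q P' Q' s)
    (hnd : (P ++ Q).Nodup) (hP : ∀ x ∈ P, Even (φ x)) (hQ : ∀ x ∈ Q, Odd (φ x))
    (hφ : ∀ x ∈ P ++ Q, φ x + s.count x ≤ N) :
    ∃ s', MedianRun (bundles N φ P) (bundles N φ Q) (bundles N (fun x => φ x + s.count x) P')
      (bundles N (fun x => φ x + s.count x) Q') s' ∧ s'.card = s.card * (2 * N - 1) ∧
      ∀ x p, s'.count (toLex (x, p)) + evenCount N (φ x) p ≤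
        2 * s.count x + evenCount N (φ x + s.count x) p := by
  induction h generalizing φ with
  | refl P Q => exact ⟨0, by simpa using refl _ _, by simp, by simp⟩
  | left hswap _ ih =>
    have hperm := hswap.perm
    obtain ⟨s', hrun, hs'⟩ := ih (((hperm.append_right _).nodup_iff).1 hnd)
      (fun x hx => hP x (hperm.mem_iff.2 hx)) hQ
      (fun x hx => hφ x ((hperm.append_right _).mem_iff.2 hx))
    exact ⟨s', left_of_adjSwaps hswap.adjSwaps_bundles hrun, hs'⟩
  | right hswap _ ih =>
    have hperm := hswap.perm
    obtain ⟨s', hrun, hs'⟩ := ih (((hperm.append_left _).nodup_iff).1 hnd) hP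
      (fun x hx => hQ x (hperm.mem_iff.2 hx))
      (fun x hx => hφ x ((hperm.append_left _).mem_iff.2 hx))
    exact ⟨s', right_of_adjSwaps hswap.adjSwaps_bundles hrun, hs'⟩
  | @mid P Q P' Q' s a b hab _ ih =>
    have hc := count_pair hab.ne
    simp only [Multiset.count_add, hc] at hφ
    have ha : Even (φ a) := hP a (by simp)
    have hb : Odd (φ b) := hQ b (by simp)
    obtain ⟨s₁, hrun₁, hcard₁, hcount₁⟩ := lift_mid (φ := φ) hN hab hnd ha hb
      (by have := hφ a (by simp); grind) (by have := hφ b (by simp); grind)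
    obtain ⟨s₂, hrun₂, hcard₂, hcount₂⟩ :=
      ih (φ := fun x => φ x + ({a, b} : Multiset α).count x) (by grind)
        (by simp only [hc]; grind) (by simp only [hc]; grind) (by simp only [hc]; grind)
    refine ⟨s₁ + s₂, ?_, ?_, fun x p => ?_⟩
    · simpa only [Multiset.count_add, add_assoc] using hrun₁.trans hrun₂
    · rw [Multiset.card_add, Multiset.card_add, Multiset.card_pair, hcard₁, hcard₂, add_mul]
    · have h₁ := hcount₁ x p
      have h₂ := hcount₂ x p
      simp only [Multiset.count_add, ← add_assoc] at h₁ h₂ ⊢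
      omega

end MedianRun

end Lift

/-- Two lists of `H` entries each, all distinct, have a run with `c` steps across the median, in
which every entry takes part in less than `D` of them. -/
def HasMedianRun (H D c : ℕ) : Prop :=
  ∃ (α : Type) (_ : Preorder α) (_ : DecidableEq α) (P Q P' Q' : List α) (s : Multiset α),
    P.length = H ∧ Q.length = H ∧ (P ++ Q).Nodup ∧ MedianRun P Q P' Q' s ∧
      s.card = 2 * c ∧ ∀ x, s.count x < D

theorem hasMedianRun_one : HasMedianRun 1 2 1 := by
  refine ⟨ℕ, inferInstance, inferInstance, [0], [1], [1], [0], _, rfl, rfl, by simp,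
    .mid (P := []) zero_lt_one (.refl _ _), rfl, fun x => ?_⟩
  rw [add_zero, count_pair zero_ne_one]
  split_ifs <;> omega

theorem HasMedianRun.lift {H D c N : ℕ} (h : HasMedianRun H D c) (hN : Even N) (hD : D ≤ N) :
    HasMedianRun (H * N) (2 * D) (c * (2 * N - 1)) := by
  obtain ⟨α, _, _, P, Q, P', Q', s, hP, hQ, hnd, hrun, hcard, hcount⟩ := h
  let φ (x : α) : ℕ := if x ∈ P then 0 else 1
  have hφ (x : α) : φ x + s.count x ≤ N := by
    have := hcount x
    grind
  obtain ⟨s', hrun', hcard', hcount'⟩ := hrun.lift (φ := φ) hN hnd (by grind) (by grind)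
    fun x _ => hφ x
  refine ⟨α ×ₗ ℕ, inferInstance, inferInstance, _, _, _, _, s', by rw [length_bundles, hP],
    by rw [length_bundles, hQ], ?_, hrun', by rw [hcard', hcard, mul_assoc], ?_⟩
  · rw [← bundles_append]
    exact nodup_bundles hnd fun x _ => by grind
  · rintro ⟨x, p⟩
    have h₁ := hcount x
    have h₂ := hcount' x p
    have h₃ := evenCount_le_one (p := p) (hφ x)
    change s'.count (toLex (x, p)) < _
    omega

section Exchange

variable {V : Type}

theorem scan_of_forall {p : V → Bool} {Q : List V} (h : ∀ u ∈ Q, p u = false) :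
    scan p Q = (false, Q.length) := by
  induction Q with
  | nil => rfl
  | cons u Q ih =>
    rw [List.forall_mem_cons] at h
    simp [scan, h.1, ih h.2]

theorem forwardScan_of_forall {A : V → V → Bool} {vertex : ℕ → Option V} {F : List V} {i j : ℕ}
    (hij : i ≤ j) (h : ∀ p, i ≤ p → p < j → ∀ u ∈ F, (vertex p).any (A u) = false) :
    forwardScan A vertex F i j = (j, (j - i) * (F.length + 2) + 1) := by
  induction hij using Nat.decreasingInduction with
  | self => rw [forwardScan, if_neg (lt_irrefl j)]; simp
  | of_succ i hij ih =>
    rw [forwardScan, if_pos hij, scan_of_forall (h i le_rfl hij), ih fun p hp => h p (by omega)]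
    obtain ⟨d, rfl⟩ := Nat.exists_eq_add_of_lt hij
    simp only [Bool.false_eq_true, if_false, Prod.mk.injEq, true_and]
    rw [show i + d + 1 - i = d + 1 by omega, show i + d + 1 - (i + 1) = d by omega]
    ring

theorem search_of_forall {A : V → V → Bool} {o : Order V} {v w : V}
    (hlt : o.position w < o.position v)
    (h : ∀ p, o.position w < p → p < o.position v → (o.vertex p).any (A w) = false) :
    search A o v w = (⟨[w], [v], Function.update (Function.update o.vertex (o.position w) none)
      (o.position v) none, o.position v, o.position v⟩,
      (o.position v - (o.position w + 1)) * 3 + 11) := by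
  have hscan := forwardScan_of_forall (A := A) (F := [w]) (vertex := Function.update
    (Function.update o.vertex (o.position w) none) (o.position v) none) hlt fun p hp hp' => by
      rw [List.forall_mem_singleton, Function.update_of_ne hp'.ne,
        Function.update_of_ne (Nat.lt_of_succ_le hp).ne']
      exact h p hp hp'
  unfold search searchLoop
  simp only [hscan, lt_irrefl, if_false, List.length_singleton, Prod.mk.injEq, true_and]
  ring

variable [DecidableEq V]

/-- The adjacency matrix `A` with the additional arc `(v, w)`. -/
def insertArc (A : V → V → Bool) (v w : V) : V → V → Bool :=
  fun x y => A x y || (decide (x = v) && decide (y = w))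

/-- The order `o` with `v` and `w` exchanged. -/
def swapOrder (o : Order V) (v w : V) : Order V where
  vertex := Function.update (Function.update o.vertex (o.position v) (some w))
    (o.position w) (some v)
  position := Function.update (Function.update o.position w (o.position v)) v (o.position w)

theorem insertArc_eq_false {A : V → V → Bool} {v w x y : V} :
    insertArc A v w x y = false ↔ A x y = false ∧ ¬(x = v ∧ y = w) := by
  simp [insertArc]

theorem reorderForward_singleton {n i : ℕ} {A : V → V → Bool} {x : V} {o : Order V} (hi : i ≤ n)
    (h : o.vertex i = none) : (reorderForward n A [x] o i).1 =
      ⟨Function.update o.vertex i (some x), Function.update o.position x i⟩ := by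
  rw [reorderForward, if_pos ⟨List.cons_ne_nil _ _, hi⟩]
  simp only [h, Option.isSome_none, Bool.false_eq_true, if_false, scan, refill]
  rw [reorderForward, if_neg (by simp)]

theorem reorderBackward_singleton {i j : ℕ} {A : V → V → Bool} {y : V} {o : Order V} (hi : 1 ≤ i)
    (hij : i < j) (hvi : o.vertex i = none)
    (h : ∀ p, i < p → p < j → ∃ d, o.vertex p = some d ∧ A d y = false) :
    (reorderBackward A [y] o j).1 =
      ⟨Function.update o.vertex i (some y), Function.update o.position y i⟩ := by
  induction j, hij using Nat.le_induction with
  | base =>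
    rw [reorderBackward, if_pos ⟨List.cons_ne_nil _ _, by omega⟩]
    simp only [Nat.succ_sub_one, hvi, Option.isSome_none, Bool.false_eq_true, if_false, scan,
      refill]
    rw [reorderBackward, if_neg (by simp)]
  | succ j hij ih =>
    obtain ⟨d, hd, hA⟩ := h j hij (by omega)
    rw [reorderBackward, if_pos ⟨List.cons_ne_nil _ _, by omega⟩]
    simp only [Nat.add_sub_cancel, hd, Option.isSome_some, if_true, scan, Option.any_some, hA,
      Bool.false_eq_true, if_false, refill]
    exact ih fun p hp hp' => h p hp (by omega)

theorem addArc_of_forall {n : ℕ} {A : V → V → Bool} {o : Order V} {v w : V}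
    (hw : 1 ≤ o.position w) (hlt : o.position w < o.position v) (hv : o.position v ≤ n)
    (hA : A w v = false) (h : ∀ p, o.position w < p → p < o.position v →
      ∃ d, o.vertex p = some d ∧ A w d = false ∧ A d v = false) :
    (addArc n A o v w).1 = some (insertArc A v w, swapOrder o v w) ∧
      o.position v - o.position w ≤ (addArc n A o v w).2 := by
  have hvw : w ≠ v := by
    rintro rfl
    exact hlt.false
  have hAw (d : V) : insertArc A v w w d = A w d := by simp [insertArc, hvw]
  have hAv (d : V) : insertArc A v w d v = A d v := by simp [insertArc, hvw.symm]
  have hsearch := search_of_forall (A := insertArc A v w) hlt fun p hp hp' => by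
    obtain ⟨d, hd, hwd, -⟩ := h p hp hp'
    rw [hd, Option.any_some, hAw, hwd]
  have hcycle : cycleTest (insertArc A v w) [v] [w] = (false, 1) := by
    simp [cycleTest, scan, hAw, hA]
  unfold insertArc at hsearch hcycle
  simp only [addArc, if_pos hlt, hsearch, hcycle, Bool.false_eq_true, if_false]
  refine ⟨?_, by omega⟩
  rw [reorderForward_singleton hv (Function.update_self _ _ _),
    reorderBackward_singleton hw hlt]
  · dsimp only
    rw [Function.update_idem, Function.update_comm hlt.ne, Function.update_idem]
    rfl
  · simp [hlt.ne]
  · intro p hp hp'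
    obtain ⟨d, hd, -, hdv⟩ := h p hp hp'
    exact ⟨d, by simp [hp'.ne, hp.ne', hd], (hAv d).trans hdv⟩

end Exchange

section Simulation

variable {V : Type} {α : Type*} {A : V → V → Bool} {o : Order V}

/-- The list `l` is the order `o`, or an initial part of it. -/
def Enumerates (o : Order V) (l : List V) : Prop :=
  ∀ k x, l[k]? = some x → o.position x = k + 1 ∧ o.vertex (k + 1) = some x

theorem Enumerates.nodup {l : List V} (h : Enumerates o l) : l.Nodup := by
  refine List.nodup_iff_getElem?_ne_getElem?.2 fun i j hij hj heq => ?_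
  have hi := h i _ (heq.trans (List.getElem?_eq_getElem hj))
  have hj := h j _ (List.getElem?_eq_getElem hj)
  omega

theorem Enumerates.swap [DecidableEq V] {v w : V} {X Y Z : List V}
    (h : Enumerates o (X ++ w :: (Y ++ v :: Z))) :
    Enumerates (swapOrder o v w) (X ++ v :: (Y ++ w :: Z)) := by
  have hw := h X.length w (by simp)
  have hv := h (X.length + 1 + Y.length) v (by grind)
  intro k x hx
  unfold swapOrder
  by_cases h₁ : k = X.length
  · grind
  by_cases h₂ : k = X.length + 1 + Y.length
  · grind
  have hk := h k x (by grind)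
  grind

/-- Both vertices are labelled, and the label of `x` is less than that of `y`. -/
def LabelLT [LT α] (g : V → Option α) (x y : V) : Prop := ∃ a ∈ g x, ∃ b ∈ g y, a < b

theorem LabelLT.trans [Preorder α] {g : V → Option α} {x y z : V} (h : LabelLT g x y)
    (h' : LabelLT g y z) : LabelLT g x z := by
  obtain ⟨a, ha, b, hb, hab⟩ := h
  obtain ⟨b', hb', c, hc, hbc⟩ := h'
  obtain rfl := Option.mem_unique hb hb'
  exact ⟨a, ha, c, hc, hab.trans hbc⟩

theorem LabelLT.irrefl [Preorder α] {g : V → Option α} {x : V} (h : LabelLT g x x) : False := by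
  obtain ⟨a, ha, b, hb, hab⟩ := h
  obtain rfl := Option.mem_unique ha hb
  exact hab.false

/-- The list `l` is a topological order of `A` that is stored in `o`, and all arcs of `A` lead to a
smaller label. -/
structure LabelledOrder [LT α] (g : V → Option α) (A : V → V → Bool) (o : Order V) (l : List V) :
    Prop where
  enumerates : Enumerates o l
  sorted : l.Pairwise fun x y => A y x = false
  labelLT : ∀ {x y}, A x y = true → LabelLT g y x

theorem LabelledOrder.eq_false [LT α] {g : V → Option α} {l : List V} {x y : V}
    (h : LabelledOrder g A o l) (hxy : ¬LabelLT g y x) : A x y = false :=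
  Bool.eq_false_iff.2 fun hA => hxy (h.labelLT hA)

theorem LabelledOrder.eq_false_of_eq_none [LT α] {g : V → Option α} {l : List V} {d : V}
    (h : LabelledOrder g A o l) (hd : g d = none) (x : V) : A x d = false ∧ A d x = false := by
  refine ⟨h.eq_false ?_, h.eq_false ?_⟩
  · rintro ⟨a, ha, -⟩
    simp [hd] at ha
  · rintro ⟨-, -, b, hb, -⟩
    simp [hd] at hb

variable [DecidableEq V] {n t : ℕ}

theorem pairwise_insertArc {L : List V} {u v : V} (hu : u ∉ L)
    (hL : L.Pairwise fun x y => A y x = false) :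
    L.Pairwise fun x y => insertArc A v u y x = false :=
  hL.imp_of_mem fun hx _ hyx => insertArc_eq_false.2 ⟨hyx, fun h => hu (h.2 ▸ hx)⟩

theorem LabelledOrder.swap [Preorder α] {g : V → Option α} {u v : V} {X Y Z : List V}
    (h : LabelledOrder g A o (X ++ u :: (Y ++ v :: Z))) (huv : LabelLT g u v)
    (hY : ∀ d ∈ Y, g d = none) :
    LabelledOrder g (insertArc A v u) (swapOrder o v u) (X ++ v :: (Y ++ u :: Z)) := by
  refine ⟨h.enumerates.swap, ?_, fun {x y} hxy => ?_⟩
  · have hnd := h.enumerates.nodup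
    have hvu : A u v = false := h.eq_false fun hvu => (huv.trans hvu).irrefl
    have hYuv (d : V) (hd : d ∈ Y) : A u d = false ∧ A d v = false :=
      ⟨(h.eq_false_of_eq_none (hY d hd) u).1, (h.eq_false_of_eq_none (hY d hd) v).2⟩
    have hsorted := h.sorted
    simp only [List.pairwise_append, List.pairwise_cons, List.nodup_append, List.nodup_cons,
      List.mem_append, List.mem_cons, not_or] at hsorted hnd ⊢
    have hX' := pairwise_insertArc (v := v) (fun hu => hnd.2.2 u hu u (.inl rfl) rfl) hsorted.1
    have hY' := pairwise_insertArc (v := v) hnd.2.1.1.1 hsorted.2.1.2.1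
    have hZ' := pairwise_insertArc (v := v) hnd.2.1.1.2.2 hsorted.2.1.2.2.1.2
    simp only [insertArc_eq_false] at hX' hY' hZ' ⊢
    clear h huv hY
    grind
  · by_cases hvu : x = v ∧ y = u
    · rwa [hvu.1, hvu.2]
    · refine h.labelLT ?_
      simpa [insertArc, hvu] using hxy

theorem LabelledOrder.addArc [Preorder α] {g : V → Option α} {u v : V} {X Y Z : List V}
    (h : LabelledOrder g A o (X ++ u :: (Y ++ v :: Z)))
    (hn : (X ++ u :: (Y ++ v :: Z)).length ≤ n) (huv : LabelLT g u v)
    (hY : ∀ d ∈ Y, g d = none) :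
    (addArc n A o v u).1 = some (insertArc A v u, swapOrder o v u) ∧
      Y.length + 1 ≤ (addArc n A o v u).2 := by
  obtain ⟨hu, -⟩ := h.enumerates X.length u (by simp)
  obtain ⟨hv, -⟩ := h.enumerates (X.length + 1 + Y.length) v (by grind)
  have hvu : A u v = false := h.eq_false fun hvu => (huv.trans hvu).irrefl
  have hsearch := addArc_of_forall (o := o) (v := v) (w := u) (n := n) (by omega) (by omega)
      (by grind) hvu fun p hp hp' => by
    obtain ⟨d, hd⟩ : ∃ d, Y[p - X.length - 2]? = some d :=
      ⟨_, List.getElem?_eq_getElem (by omega)⟩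
    have hdY := hY d (List.mem_of_getElem? hd)
    obtain ⟨-, hp⟩ := h.enumerates (p - 1) d (by grind)
    rw [Nat.sub_add_cancel (by omega)] at hp
    exact ⟨d, hp, (h.eq_false_of_eq_none hdY u).1, (h.eq_false_of_eq_none hdY v).2⟩
  exact ⟨hsearch.1, by omega⟩

/-- Some sequence of arcs, none of which is in `A` and all of which lead to a smaller label, takes
time at least `t`. -/
def HasCostlyArcs [LT α] (n : ℕ) (g : V → Option α) (A : V → V → Bool) (o : Order V) (t : ℕ) :
    Prop :=
  ∃ arcs : List (V × V), arcs.Nodup ∧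
    (∀ x y, (x, y) ∈ arcs → A x y = false ∧ LabelLT g y x) ∧ t ≤ timeFrom n A o arcs

theorem HasCostlyArcs.mono [LT α] {g : V → Option α} {t' : ℕ} (h : HasCostlyArcs n g A o t)
    (ht : t' ≤ t) : HasCostlyArcs n g A o t' := by
  obtain ⟨arcs, hnd, harcs, htime⟩ := h
  exact ⟨arcs, hnd, harcs, ht.trans htime⟩

theorem HasCostlyArcs.cons [LT α] {g : V → Option α} {v w : V} {o' : Order V} {t' : ℕ}
    (h : HasCostlyArcs n g (insertArc A v w) o' t) (hA : A v w = false) (hwv : LabelLT g w v)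
    (hadd : (addArc n A o v w).1 = some (insertArc A v w, o'))
    (ht' : t' ≤ (addArc n A o v w).2) : HasCostlyArcs n g A o (t' + t) := by
  obtain ⟨arcs, hnd, harcs, htime⟩ := h
  simp only [insertArc_eq_false] at harcs
  refine ⟨(v, w) :: arcs, List.nodup_cons.2 ⟨fun hmem => ?_, hnd⟩, fun x y hxy => ?_, ?_⟩
  · exact (harcs _ _ hmem).1.2 ⟨rfl, rfl⟩
  · rcases List.mem_cons.1 hxy with h | h
    · cases h
      exact ⟨hA, hwv⟩
    · exact ⟨(harcs x y h).1.1, (harcs x y h).2⟩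
  · simp only [timeFrom, hadd]
    omega

theorem LabelledOrder.hasCostlyArcs [Preorder α] {g : V → Option α} {l : List V} {a b : α}
    {C M D : List (Option α)} (h : LabelledOrder g A o l) (hn : l.length ≤ n) (hab : a < b)
    (hl : l.map g = C ++ some a :: (M ++ some b :: D)) (hM : ∀ m ∈ M, m = none)
    (ih : ∀ {A o l}, LabelledOrder g A o l → l.length ≤ n →
      l.map g = C ++ some b :: (M ++ some a :: D) → HasCostlyArcs n g A o t) :
    HasCostlyArcs n g A o (M.length + 1 + t) := by
  obtain ⟨X, l₁, rfl, rfl, hl₁⟩ := List.map_eq_append_iff.1 hl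
  obtain ⟨u, l₂, rfl, hu, hl₂⟩ := List.map_eq_cons_iff.1 hl₁
  obtain ⟨Y, l₃, rfl, rfl, hl₃⟩ := List.map_eq_append_iff.1 hl₂
  obtain ⟨v, Z, rfl, hv, rfl⟩ := List.map_eq_cons_iff.1 hl₃
  rw [List.forall_mem_map] at hM
  have huv : LabelLT g u v := ⟨a, hu, b, hv, hab⟩
  obtain ⟨hadd, htime⟩ := h.addArc hn huv hM
  rw [List.length_map]
  refine (ih (h.swap huv hM) ?_ ?_).cons ?_ huv hadd htime
  · simpa using hn
  · simp [hu, hv]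
  · have := h.sorted
    simp only [List.pairwise_append, List.pairwise_cons] at this
    exact this.2.1.1 v (by simp)

theorem MedianRun.hasCostlyArcs [Preorder α] {g : V → Option α} {P Q P' Q' : List α}
    {s : Multiset α} (h : MedianRun P Q P' Q' s) {K : ℕ} {l : List V}
    (hlo : LabelledOrder g A o l) (hn : l.length ≤ n)
    (hl : l.map g = P.map some ++ (List.replicate K none ++ Q.map some)) :
    HasCostlyArcs n g A o (s.card / 2 * (K + 1)) := by
  induction h generalizing A o l with
  | refl => exact ⟨[], .nil, by simp, by simp⟩
  | @left _ _ Q _ _ _ hP _ ih =>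
    obtain ⟨l₁, l₂, hab⟩ := hP
    refine (hlo.hasCostlyArcs (C := l₁.map some) (M := [])
      (D := l₂.map some ++ (.replicate K none ++ Q.map some)) hn hab (by simpa using hl) (by simp)
      fun h hn hl => ih h hn (by simpa using hl)).mono (by omega)
  | @right P _ _ _ _ _ hQ _ ih =>
    obtain ⟨l₁, l₂, hab⟩ := hQ
    refine (hlo.hasCostlyArcs (C := P.map some ++ (.replicate K none ++ l₁.map some)) (M := [])
      (D := l₂.map some) hn hab (by simpa using hl) (by simp)
      fun h hn hl => ih h hn (by simpa using hl)).mono (by omega)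
  | @mid P Q _ _ s a b hab _ ih =>
    refine (hlo.hasCostlyArcs (C := P.map some) (M := .replicate K none) (D := Q.map some) hn hab
      (by simpa using hl) (fun _ => List.eq_of_mem_replicate)
      fun h hn hl => ih h hn (by simpa using hl)).mono (le_of_eq ?_)
    rw [Multiset.card_add, Multiset.card_pair, List.length_replicate,
      Nat.add_div_left _ two_pos]
    ring

end Simulation

theorem labelledOrder_initialOrder {α : Type*} [LT α] {n : ℕ} (σ : Equiv.Perm (Fin n))
    (g : Fin n → Option α) :
    LabelledOrder g (fun _ _ => false) (initialOrder σ) (List.ofFn σ.symm) where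
  enumerates k x hx := by
    obtain ⟨hk, rfl⟩ := List.getElem?_eq_some_iff.1 hx
    rw [List.length_ofFn] at hk
    simp [initialOrder, Nat.succ_le_of_lt hk]
  sorted := List.pairwise_of_forall fun _ _ => rfl
  labelLT h := nomatch h

theorem isAcyclicSequence_of_labelLT {V : Type} {α : Type*} [Preorder α] {g : V → Option α}
    {arcs : List (V × V)} (hnd : arcs.Nodup) (h : ∀ x y, (x, y) ∈ arcs → LabelLT g y x) :
    IsAcyclicSequence arcs := by
  have htrans (x y : V) (hxy : Relation.TransGen (fun x y => (x, y) ∈ arcs) x y) :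
      LabelLT g y x := by
    induction hxy with
    | single hxy => exact h _ _ hxy
    | tail _ hyz ih => exact (h _ _ hyz).trans ih
  exact ⟨hnd, fun v hv => (htrans v v hv).irrefl⟩

theorem HasMedianRun.exists_le_time {H D c K n : ℕ} (h : HasMedianRun H D c) (hn : n = 2 * H + K)
    (σ : Equiv.Perm (Fin n)) :
    ∃ arcs, IsAcyclicSequence arcs ∧ c * (K + 1) ≤ time σ arcs := by
  obtain ⟨α, _, _, P, Q, P', Q', s, hP, hQ, -, hrun, hcard, -⟩ := h
  let labels : List (Option α) := P.map some ++ (.replicate K none ++ Q.map some)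
  have hlabels : labels.length = n := by
    simp only [labels, List.length_append, List.length_map, List.length_replicate]
    omega
  let g (v : Fin n) : Option α := labels[σ v]
  have hg : (List.ofFn σ.symm).map g = labels := by
    refine List.ext_getElem (by simp [hlabels]) fun k _ _ => ?_
    simp [g]
  obtain ⟨arcs, hnd, harcs, htime⟩ :=
    hrun.hasCostlyArcs (n := n) (labelledOrder_initialOrder σ g) (by simp) hg
  rw [hcard, Nat.mul_div_cancel_left c two_pos] at htime
  exact ⟨arcs, isAcyclicSequence_of_labelLT hnd fun x y hxy => (harcs x y hxy).2, htime⟩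

theorem exists_hasMedianRun (i : ℕ) :
    ∃ c, HasMedianRun (2 ^ (i + 1).choose 2) (2 ^ (i + 1)) c ∧
      2 ^ (i + 1).choose 2 * (2 ^ i + 1) ≤ 2 * c := by
  induction i with
  | zero => exact ⟨1, hasMedianRun_one, le_rfl⟩
  | succ i ih =>
    obtain ⟨c, hc, hle⟩ := ih
    have hpow : 2 ^ (i + 2).choose 2 = 2 ^ (i + 1).choose 2 * 2 ^ (i + 1) := by
      rw [Nat.choose_succ_succ', Nat.choose_one_right, pow_add, mul_comm]
    refine ⟨c * (2 * 2 ^ (i + 1) - 1), ?_, ?_⟩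
    · rw [hpow, pow_succ' 2 (i + 1)]
      exact hc.lift (by simp [pow_succ']) le_rfl
    · have hfactor : 2 ^ (i + 1) * (2 ^ (i + 1) + 1) ≤ (2 ^ i + 1) * (2 * 2 ^ (i + 1) - 1) := by
        obtain ⟨q, hq⟩ := Nat.exists_eq_add_of_le (Nat.one_le_two_pow (n := i))
        rw [pow_succ', hq, show 2 * (2 * (1 + q)) - 1 = 4 * q + 3 by omega]
        nlinarith
      calc 2 ^ (i + 2).choose 2 * (2 ^ (i + 1) + 1)
          = 2 ^ (i + 1).choose 2 * (2 ^ (i + 1) * (2 ^ (i + 1) + 1)) := by rw [hpow, mul_assoc]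
        _ ≤ 2 ^ (i + 1).choose 2 * ((2 ^ i + 1) * (2 * 2 ^ (i + 1) - 1)) := by gcongr
        _ = 2 ^ (i + 1).choose 2 * (2 ^ i + 1) * (2 * 2 ^ (i + 1) - 1) := by rw [mul_assoc]
        _ ≤ 2 * c * (2 * 2 ^ (i + 1) - 1) := by gcongr
        _ = 2 * (c * (2 * 2 ^ (i + 1) - 1)) := mul_assoc _ _ _

theorem HasMedianRun.exists_sq_mul_le_time {H D c n q : ℕ} (h : HasMedianRun H D c)
    (hq : H * q ≤ 2 * c) (hn : 4 * H ≤ n + 2) (hn' : n ≤ 8 * H)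
    (σ : Equiv.Perm (Fin n)) :
    ∃ arcs, IsAcyclicSequence arcs ∧ n ^ 2 * q ≤ 32 * time σ arcs := by
  obtain ⟨K, rfl⟩ : ∃ K, n = 2 * H + K := Nat.exists_eq_add_of_le (by omega)
  obtain ⟨arcs, harcs, htime⟩ := h.exists_le_time rfl σ
  refine ⟨arcs, harcs, ?_⟩
  calc (2 * H + K) ^ 2 * q = (2 * H + K) * (2 * H + K) * q := by ring
    _ ≤ 8 * H * (2 * (K + 1)) * q := by gcongr; omega
    _ = 16 * (K + 1) * (H * q) := by ring
    _ ≤ 16 * (K + 1) * (2 * c) := by gcongr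
    _ = 32 * (c * (K + 1)) := by ring
    _ ≤ _ := by gcongr

theorem exists_two_pow_choose_near {n : ℕ} (hn : 8 ≤ n) :
    ∃ i, 2 ^ (2 + (i + 2).choose 2) ≤ n ∧ n ≤ 2 ^ (2 + (i + 3).choose 2) := by
  by_contra! h
  have hle (i : ℕ) : 2 ^ (2 + (i + 2).choose 2) ≤ n := by
    induction i with
    | zero => exact hn
    | succ i ih => exact (h i ih).le
  have hpow : 2 ^ n ≤ 2 ^ (2 + (n + 2).choose 2) := by
    refine Nat.pow_le_pow_right two_pos ?_
    rw [Nat.choose_succ_succ', Nat.choose_one_right]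
    omega
  exact absurd (hpow.trans (hle n)) (not_le.2 Nat.lt_two_pow_self)

theorem exists_even_mul_near {H k n : ℕ} (hk : 0 < k) (hn : k * (8 * H) ≤ n) (hH : 0 < H) :
    ∃ N, Even N ∧ 2 * k ≤ N ∧ 4 * (H * N) ≤ n ∧ n ≤ 8 * (H * N) := by
  have hkt : k ≤ n / (8 * H) := (Nat.le_div_iff_mul_le (by omega)).2 hn
  have hle : n / (8 * H) * (8 * H) ≤ n := Nat.div_mul_le_self n (8 * H)
  have hlt : n < (n / (8 * H) + 1) * (8 * H) := Nat.lt_mul_of_div_lt (Nat.lt_succ_self _) (by omega)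
  refine ⟨2 * (n / (8 * H)), even_two_mul _, by omega, ?_, ?_⟩ <;> nlinarith

theorem exists_le_time {n : ℕ} (hn : 2 ≤ n) (σ : Equiv.Perm (Fin n)) :
    ∃ arcs i, IsAcyclicSequence arcs ∧ n ≤ 2 ^ (2 + (i + 3).choose 2) ∧
      n ^ 2 * 2 ^ i ≤ 32 * time σ arcs := by
  obtain hn8 | hn8 := lt_or_ge n 8
  · obtain ⟨arcs, harcs, htime⟩ := hasMedianRun_one.exists_sq_mul_le_time (q := 2 ^ 0)
      (by norm_num) (by omega) hn8.le σ
    exact ⟨arcs, 0, harcs, hn8.le.trans (by decide), htime⟩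
  obtain ⟨i, hi, hi'⟩ := exists_two_pow_choose_near hn8
  obtain ⟨c, hc, hle⟩ := exists_hasMedianRun i
  set H := 2 ^ (i + 1).choose 2 with hH
  have hHn : 2 ^ i * (8 * H) ≤ n :=
    calc 2 ^ i * (8 * H) = 2 ^ (2 + (i + 2).choose 2) := by
          rw [hH, Nat.choose_succ_succ' (i + 1), Nat.choose_one_right]
          ring
      _ ≤ n := hi
  obtain ⟨N, hN, hiN, hNn, hnN⟩ := exists_even_mul_near (by positivity) hHn (by positivity)
  have hN0 : 0 < N := hiN.trans_lt' (by positivity)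
  have hcN : H * N * 2 ^ i ≤ 2 * (c * (2 * N - 1)) :=
    calc H * N * 2 ^ i = H * 2 ^ i * N := by ring
      _ ≤ H * (2 ^ i + 1) * N := by gcongr; omega
      _ ≤ 2 * c * (2 * N - 1) := by gcongr; omega
      _ = 2 * (c * (2 * N - 1)) := by ring
  obtain ⟨arcs, harcs, htime⟩ := (hc.lift hN (by rwa [pow_succ'])).exists_sq_mul_le_time hcN
    (by omega) hnN σ
  exact ⟨arcs, i, harcs, hi', htime⟩

theorem two_pow_sqrt_le {n i : ℕ} (hn : 0 < n) (h : n ≤ 2 ^ (2 + (i + 3).choose 2)) :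
    (2 : ℝ) ^ √(2 * Real.logb 2 n) ≤ 16 * 2 ^ i := by
  have hlog : Real.logb 2 n ≤ 2 + (i + 3).choose 2 := by
    rw [Real.logb_le_iff_le_rpow one_lt_two (by exact_mod_cast hn)]
    exact_mod_cast h
  rw [Nat.cast_choose_two] at hlog
  have hsqrt : √(2 * Real.logb 2 n) ≤ (i + 4 : ℕ) := by
    refine Real.sqrt_le_iff.2 ⟨by positivity, ?_⟩
    push_cast at hlog ⊢
    nlinarith [i.cast_nonneg (α := ℝ)]
  calc (2 : ℝ) ^ √(2 * Real.logb 2 n) ≤ (2 : ℝ) ^ ((i + 4 : ℕ) : ℝ) :=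
        Real.rpow_le_rpow_of_exponent_le one_le_two hsqrt
    _ = 16 * 2 ^ i := by rw [Real.rpow_natCast, pow_add]; norm_num; ring

end TopSearch

theorem mainTheorem7 :
    ∃ c : ℝ, 0 < c ∧ ∀ n : ℕ, 2 ≤ n → ∀ σ : Equiv.Perm (Fin n),
      ∃ arcs : List (Fin n × Fin n), TopSearch.IsAcyclicSequence arcs ∧
        c * (n : ℝ) ^ 2 * (2 : ℝ) ^ Real.sqrt (2 * Real.logb 2 (n : ℝ)) ≤
          (TopSearch.time σ arcs : ℝ) := by
  refine ⟨1 / 512, by norm_num, fun n hn σ => ?_⟩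
  obtain ⟨arcs, i, harcs, hi, htime⟩ := TopSearch.exists_le_time hn σ
  have htime' : (n : ℝ) ^ 2 * 2 ^ i ≤ 32 * TopSearch.time σ arcs := by exact_mod_cast htime
  refine ⟨arcs, harcs, ?_⟩
  calc 1 / 512 * (n : ℝ) ^ 2 * (2 : ℝ) ^ √(2 * Real.logb 2 n)
      ≤ 1 / 512 * (n : ℝ) ^ 2 * (16 * 2 ^ i) := by
        gcongr
        exact TopSearch.two_pow_sqrt_le (by omega) hi
    _ = 1 / 32 * ((n : ℝ) ^ 2 * 2 ^ i) := by ring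
    _ ≤ TopSearch.time σ arcs := by linarith
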